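/- Let $1\le k\le n-1$. Balls $1,\dots,n$ are placed one after the other, in this order, into pits $1,\dots,n$, at most one ball per pit. Each of the first $k$ ("absent-minded") balls takes a pit chosen uniformly at random among the pits that are still empty. Each ball $i>k$ takes pit $i$ if that pit is still empty, and otherwise takes a pit chosen uniformly at random among the pits that are still empty. Let $W_{n,k}$ be the number of balls $i\in\{1,\dots,n\}$ that do not end up in pit $i$. Then, for every fixed $k\ge 1$, as $n\to\infty$, $$\frac{\mathbb{E}(W_{n,k})}{k\log n}\to 1,\qquad \frac{\mathbb{V}(W_{n,k})}{k\log n}\to 1,$$ and $$\frac{W_{n,k}-k\log n}{\sqrt{k\log n}}$$ converges in distribution to the standard normal distribution. -/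

import Mathlib

open MeasureTheory ProbabilityTheory Filter Topology

/-- Balls and pits are both labelled by `Fin n`, that is by `0, …, n - 1` in place of `1, …, n`.
Suppose that the balls `0, …, m - 1` have been placed, ball `j` in pit `f j`. This is the set of
pits among which ball `m` chooses, uniformly at random: its own pit alone if ball `m` is not one
of the first `k` balls and its own pit is still empty, and all empty pits otherwise. -/
def pitChoices (k : ℕ) {n m : ℕ} (hm : m < n) (f : Fin m → Fin n) : Finset (Fin n) :=
  if k ≤ m ∧ ∀ j, f j ≠ ⟨m, hm⟩ then {⟨m, hm⟩}
  else Finset.univ.filter fun p => ∀ j, f j ≠ p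

theorem pitChoices_nonempty (k : ℕ) {n m : ℕ} (hm : m < n) (f : Fin m → Fin n) :
    (pitChoices k hm f).Nonempty := by
  unfold pitChoices
  split_ifs with h
  · exact Finset.singleton_nonempty _
  · by_contra hne
    have hs : Function.Surjective f := by
      intro p
      by_contra hp
      push Not at hp
      exact hne ⟨p, by simpa using hp⟩
    have := Fintype.card_le_of_surjective f hs
    simp at this
    omega

/-- The joint law of the pits taken by the first `m` of `n` balls, the balls being placed one after
the other in the order of their labels, the first `k` of them being absent-minded. -/
noncomputable def partialPlacementLaw (k n : ℕ) : (m : ℕ) → m ≤ n → PMF (Fin m → Fin n)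
  | 0, _ => PMF.pure Fin.elim0
  | m + 1, hm =>
    (partialPlacementLaw k n m (Nat.le_of_succ_le hm)).bind fun f =>
      (PMF.uniformOfFinset (pitChoices k hm f) (pitChoices_nonempty k hm f)).map fun p =>
        Fin.snoc (α := fun _ => Fin n) f p

/-- The law of the complete placement of `n` balls in `n` pits, the first `k` balls being
absent-minded. -/
noncomputable def placementMeasure (k n : ℕ) : Measure (Fin n → Fin n) :=
  (partialPlacementLaw k n n le_rfl).toMeasure

instance placementMeasure_isProbabilityMeasure (k n : ℕ) :
    IsProbabilityMeasure (placementMeasure k n) :=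
  PMF.toMeasure.isProbabilityMeasure _

/-- The number of balls that do not meet their assigned pit. -/
def misplaced (n : ℕ) (N : Fin n → Fin n) : ℕ :=
  ∑ i : Fin n, if N i ≠ i then 1 else 0

/-! The count `misplacedFrom` omits the first `k` balls, so it differs from `misplaced` by at most
`k`, which is negligible at scale `√(k log n)`. Its law is exactly that of a sum of independent
Bernoulli variables with parameters `k / s`, `k < s ≤ n`.

To see this, refine the generating polynomial by the set `T` of occupied pits. For `m ≥ k` it
vanishes unless `T` has `m` elements and contains the pits `k, …, m - 1`, and it is the same for all
such `T`. Going to `m + 1`, either ball `m` took its own pit (factor `1`), or it took one of the `k`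
other possible pits of `T`, each with probability `1 / (n - m)`. So the polynomial gains a factor `1
+ k / (n - m) * X` (`exists_occupationPoly_of_ge`); normalising at `X = 1` gives the Bernoulli
product (`sum_misplacedFrom_eq_prod`).

Mean and variance follow from derivatives at `1`, harmonic sums and `∑ 1 / s ^ 2 < ∞`. For the limit
law, the characteristic function is compared with that of a Poisson variable of the same mean, with
error `O(θ ^ 2)` at `θ = t / √(k log n)`. -/

/-! ### Recursion for the occupation polynomials -/

open Polynomial in
/-- The generating polynomial of the number of balls `i ≥ k` not in their own pit, restricted to the
event that the first `m` balls occupy exactly the pits in `T`. -/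
noncomputable def occupationPoly (k n m : ℕ) (hm : m ≤ n) (T : Finset (Fin n)) : ℝ[X] :=
  ∑ f : Fin m → Fin n, if Finset.univ.image f = T then
    C (partialPlacementLaw k n m hm f).toReal *
      X ^ (∑ i : Fin m, if k ≤ (i : ℕ) ∧ (f i : ℕ) ≠ i then 1 else 0) else 0

/-- The pits among which ball `m` chooses, in terms of the set `T` of occupied pits. -/
def choicesOf (k : ℕ) {n m : ℕ} (hm : m < n) (T : Finset (Fin n)) : Finset (Fin n) :=
  if k ≤ m ∧ ⟨m, hm⟩ ∉ T then {⟨m, hm⟩} else Tᶜ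

theorem pitChoices_eq_choicesOf (k : ℕ) {n m : ℕ} (hm : m < n) (f : Fin m → Fin n) :
    pitChoices k hm f = choicesOf k hm (Finset.univ.image f) := by
  unfold pitChoices choicesOf
  congr 1
  · simp
  · ext p
    simp

theorem partialPlacementLaw_snoc (k n m : ℕ) (hm : m + 1 ≤ n) (f : Fin m → Fin n) (p : Fin n) :
    (partialPlacementLaw k n (m + 1) hm (Fin.snoc (α := fun _ => Fin n) f p)).toReal =
      (partialPlacementLaw k n m (Nat.le_of_succ_le hm) f).toReal *
        if p ∈ pitChoices k hm f then ((pitChoices k hm f).card : ℝ)⁻¹ else 0 := by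
  rw [partialPlacementLaw, PMF.bind_apply, tsum_eq_single f, PMF.map_apply, tsum_eq_single p]
  · simp only [if_true, ENNReal.toReal_mul, PMF.uniformOfFinset_apply]
    congr 1
    split_ifs <;> simp
  · intro q hq
    rw [if_neg]
    intro h
    exact hq (by simpa using (congrFun h (Fin.last m)).symm)
  · intro g hg
    rw [PMF.map_apply, ENNReal.tsum_eq_zero.2, mul_zero]
    intro q
    rw [if_neg]
    intro h
    apply hg
    have := congrArg (Fin.init (α := fun _ => Fin n)) h
    simpa using this.symm

open Polynomial in
theorem occupationPoly_zero (k n : ℕ) (T : Finset (Fin n)) :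
    occupationPoly k n 0 (Nat.zero_le n) T = if T.card = 0 then 1 else 0 := by
  have h1 : (partialPlacementLaw k n 0 (Nat.zero_le n) default).toReal = 1 := by
    rw [partialPlacementLaw, PMF.pure_apply, if_pos (Subsingleton.elim _ _)]
    simp
  rw [occupationPoly, Fintype.sum_unique, h1]
  simp [eq_comm]

theorem image_snoc {n m : ℕ} (f : Fin m → Fin n) (p : Fin n) :
    Finset.univ.image (Fin.snoc (α := fun _ => Fin n) f p : Fin (m + 1) → Fin n) =
      insert p (Finset.univ.image f) := by
  ext q
  simp only [Finset.mem_image, Finset.mem_univ, true_and, Finset.mem_insert]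
  constructor
  · rintro ⟨i, rfl⟩
    refine Fin.lastCases ?_ (fun j => ?_) i
    · simp
    · right; exact ⟨j, by simp⟩
  · rintro (rfl | ⟨j, rfl⟩)
    · exact ⟨Fin.last m, by simp⟩
    · exact ⟨j.castSucc, by simp⟩

theorem notMem_of_mem_choicesOf {k n m : ℕ} {hm : m < n} {T : Finset (Fin n)} {p : Fin n}
    (hp : p ∈ choicesOf k hm T) : p ∉ T := by
  unfold choicesOf at hp
  split_ifs at hp with h
  · rw [Finset.mem_singleton] at hp
    exact hp ▸ h.2
  · simpa using hp

open Polynomial in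
/-- The probability that ball `m` takes pit `p` when the pits in `T` are occupied, times `X` if ball
`m` is not absent-minded and `p` is not its own pit. -/
noncomputable def stepPoly (k : ℕ) {n m : ℕ} (hm : m < n) (T : Finset (Fin n)) (p : Fin n) : ℝ[X] :=
  if p ∈ choicesOf k hm T then
    C ((choicesOf k hm T).card : ℝ)⁻¹ * X ^ (if k ≤ m ∧ (p : ℕ) ≠ m then 1 else 0) else 0

theorem stepPoly_eq_zero {k n m : ℕ} {hm : m < n} {T : Finset (Fin n)} {p : Fin n}
    (hp : p ∉ choicesOf k hm T) : stepPoly k hm T p = 0 :=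
  if_neg hp

open Polynomial in
theorem stepPoly_of_lt {k n m : ℕ} {hm : m < n} {T : Finset (Fin n)} {p : Fin n}
    (hmk : m < k) (hp : p ∉ T) (hT : T.card = m) :
    stepPoly k hm T p = C ((n - m : ℕ) : ℝ)⁻¹ := by
  have h : choicesOf k hm T = Tᶜ := if_neg fun h => by omega
  rw [stepPoly, h, if_pos (Finset.mem_compl.2 hp), Finset.card_compl, hT, Fintype.card_fin,
    if_neg (fun h => by omega), pow_zero, mul_one]

theorem stepPoly_own {k n m : ℕ} {hm : m < n} {T : Finset (Fin n)}
    (hkm : k ≤ m) (hT : ⟨m, hm⟩ ∉ T) : stepPoly k hm T ⟨m, hm⟩ = 1 := by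
  have h : choicesOf k hm T = {⟨m, hm⟩} := if_pos ⟨hkm, hT⟩
  simp [stepPoly, h]

open Polynomial in
theorem stepPoly_other {k n m : ℕ} {hm : m < n} {T : Finset (Fin n)} {p : Fin n}
    (hkm : k ≤ m) (hmT : ⟨m, hm⟩ ∈ T) (hp : p ∉ T) (hT : T.card = m) :
    stepPoly k hm T p = C ((n - m : ℕ) : ℝ)⁻¹ * X := by
  have h : choicesOf k hm T = Tᶜ := if_neg fun h => h.2 hmT
  have hpm : (p : ℕ) ≠ m := fun h => hp (by rwa [show p = ⟨m, hm⟩ from Fin.ext h])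
  rw [stepPoly, h, if_pos (Finset.mem_compl.2 hp), Finset.card_compl, hT, Fintype.card_fin,
    if_pos ⟨hkm, hpm⟩, pow_one]

-- Fixing the pit `p` of the last ball determines the previously occupied set: a ball never takes an
-- occupied pit, so it must be `T.erase p`.
open Polynomial in
theorem sum_snoc_eq_stepPoly_mul (k n m : ℕ) (hm : m + 1 ≤ n) (T : Finset (Fin n)) (p : Fin n) :
    (∑ f : Fin m → Fin n,
      if Finset.univ.image (Fin.snoc (α := fun _ => Fin n) f p : Fin (m + 1) → Fin n) = T then
      C (partialPlacementLaw k n (m + 1) hm (Fin.snoc (α := fun _ => Fin n) f p)).toReal *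
      X ^ (∑ i : Fin (m + 1), if k ≤ (i : ℕ) ∧
        ((Fin.snoc (α := fun _ => Fin n) f p : Fin (m + 1) → Fin n) i : ℕ) ≠ i then 1 else 0)
        else (0 : ℝ[X])) = if p ∈ T then
      stepPoly k hm (T.erase p) p * occupationPoly k n m (Nat.le_of_succ_le hm) (T.erase p)
      else 0 := by
  by_cases hpT : p ∈ T
  · rw [if_pos hpT, occupationPoly, Finset.mul_sum]
    refine Finset.sum_congr rfl fun f _ => ?_
    rw [image_snoc, partialPlacementLaw_snoc, pitChoices_eq_choicesOf]
    by_cases hf : Finset.univ.image f = T.erase p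
    · rw [hf, if_pos (Finset.insert_erase hpT), if_pos rfl, stepPoly, Fin.sum_univ_castSucc]
      simp only [Fin.snoc_castSucc, Fin.snoc_last, Fin.val_castSucc, Fin.val_last, C_mul]
      by_cases hpc : p ∈ choicesOf k hm (T.erase p)
      · rw [if_pos hpc, if_pos hpc, pow_add]
        ring
      · rw [if_neg hpc, if_neg hpc]
        simp
    · rw [if_neg hf, mul_zero]
      by_cases h2 : p ∈ choicesOf k hm (Finset.univ.image f)
      · refine if_neg fun h1 => hf ?_
        rw [← h1, Finset.erase_insert (notMem_of_mem_choicesOf h2)]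
      · simp [h2]
  · rw [if_neg hpT]
    refine Finset.sum_eq_zero fun f _ => if_neg fun h => hpT ?_
    rw [← h, image_snoc]
    exact Finset.mem_insert_self _ _

theorem occupationPoly_succ (k n m : ℕ) (hm : m + 1 ≤ n) (T : Finset (Fin n)) :
    occupationPoly k n (m + 1) hm T = ∑ p ∈ T,
      stepPoly k hm (T.erase p) p * occupationPoly k n m (Nat.le_of_succ_le hm) (T.erase p) := by
  have h := Finset.sum_congr rfl fun p (_ : p ∈ Finset.univ) => sum_snoc_eq_stepPoly_mul k n m hm T p
  rw [Finset.sum_ite_mem, Finset.univ_inter] at h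
  rw [← h, occupationPoly, ← (Fin.snocEquiv fun _ => Fin n).sum_comp, Fintype.sum_prod_type]
  rfl

/-! ### Closed form of the occupation polynomials -/

-- Absent-minded balls treat all pits alike and are not counted by the exponent, so only the size of
-- `T` matters and no power of `X` appears.
open Polynomial in
theorem exists_occupationPoly_of_le (k n m : ℕ) (hm : m ≤ n) (hmk : m ≤ k) :
    ∃ c : ℝ, ∀ T : Finset (Fin n),
      occupationPoly k n m hm T = if T.card = m then C c else 0 := by
  induction m with
  | zero => exact ⟨1, fun T => by rw [occupationPoly_zero, C_1]⟩
  | succ m ih =>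
    obtain ⟨c, hc⟩ := ih (Nat.le_of_succ_le hm) (Nat.le_of_succ_le hmk)
    -- Any of the `m + 1` pits of `T` may be the last one taken, each with probability `1 / (n -
    -- m)`.
    refine ⟨(m + 1 : ℕ) * (((n - m : ℕ) : ℝ)⁻¹ * c), fun T => ?_⟩
    rw [occupationPoly_succ]
    by_cases hT : T.card = m + 1
    · rw [if_pos hT, Finset.sum_congr rfl (g := fun _ => C (((n - m : ℕ) : ℝ)⁻¹ * c)),
        Finset.sum_const, hT, nsmul_eq_mul, ← C_eq_natCast, ← C_mul]
      intro p hp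
      have hcard : (T.erase p).card = m := by rw [Finset.card_erase_of_mem hp, hT]; rfl
      rw [hc, if_pos hcard, stepPoly_of_lt (by omega) (Finset.notMem_erase _ _) hcard, C_mul]
    · rw [if_neg hT]
      refine Finset.sum_eq_zero fun p hp => ?_
      rw [hc, if_neg, mul_zero]
      have := Finset.card_erase_add_one hp
      omega

/-- The pits occupied after the first `m ≥ k` balls have been placed: `m` of them, among them all
the pits `k, …, m - 1`. -/
def IsOccupied (k m : ℕ) {n : ℕ} (T : Finset (Fin n)) : Prop :=
  T.card = m ∧ ∀ i : Fin n, k ≤ (i : ℕ) → (i : ℕ) < m → i ∈ T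

/-- This count is the source of the coefficient `k` in every factor: a displaced ball can only have
taken one of these pits. -/
theorem IsOccupied.card_filter {k m n : ℕ} {T : Finset (Fin n)} (hT : IsOccupied k m T)
    (hkm : k ≤ m) (hm : m ≤ n) :
    (T.filter fun p : Fin n => ¬ (k ≤ (p : ℕ) ∧ (p : ℕ) < m)).card = k := by
  have h1 := T.card_filter_add_card_filter_not (fun p => k ≤ (p : ℕ) ∧ (p : ℕ) < m)
  have h2 : (T.filter fun p : Fin n => k ≤ (p : ℕ) ∧ (p : ℕ) < m).card = m - k := by
    rw [← Nat.card_Ico, ← Finset.card_map Fin.valEmbedding]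
    congr 1
    ext i
    simp only [Finset.mem_map, Finset.mem_filter, Fin.valEmbedding_apply, Finset.mem_Ico]
    constructor
    · rintro ⟨p, ⟨-, h⟩, rfl⟩
      exact h
    · intro h
      exact ⟨⟨i, by omega⟩, ⟨hT.2 _ h.1 h.2, h⟩, rfl⟩
  have := hT.1
  omega

open Polynomial in
open Classical in
theorem exists_occupationPoly_of_ge (k n : ℕ) (hkn : k ≤ n) :
    ∃ c : ℝ, ∀ m (hm : m ≤ n), k ≤ m → ∀ T : Finset (Fin n),
      occupationPoly k n m hm T = if IsOccupied k m T then
          C c * ∏ j ∈ Finset.Ico k m, (1 + C ((k : ℝ) / (n - j : ℕ)) * X) else 0 := by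
  obtain ⟨c, hc⟩ := exists_occupationPoly_of_le k n k hkn le_rfl
  refine ⟨c, fun m hm hkm => ?_⟩
  induction m, hkm using Nat.le_induction with
  | base =>
    intro T
    rw [hc]
    have : IsOccupied k k T ↔ T.card = k := ⟨fun h => h.1, fun h => ⟨h, fun i _ _ => by omega⟩⟩
    simp [this]
  | succ m hkm ih =>
    replace ih := ih (Nat.le_of_succ_le hm)
    intro T
    rw [occupationPoly_succ]
    set M : Fin n := ⟨m, hm⟩
    set R := C c * ∏ j ∈ Finset.Ico k m, (1 + C ((k : ℝ) / (n - j : ℕ)) * X) with hR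
    by_cases hT : IsOccupied k (m + 1) T
    · have hMT : M ∈ T := hT.2 M hkm (Nat.lt_succ_self m)
      have hcard : ∀ p ∈ T, (T.erase p).card = m := fun p hp => by
        rw [Finset.card_erase_of_mem hp, hT.1]; rfl
      have hocc : ∀ p ∈ T, (IsOccupied k m (T.erase p) ↔ ¬ (k ≤ (p : ℕ) ∧ (p : ℕ) < m)) := by
        refine fun p hp => ⟨fun h h' => Finset.notMem_erase _ _ (h.2 p h'.1 h'.2), fun h =>
          ⟨hcard p hp, fun i h1 h2 => Finset.mem_erase.2 ⟨?_, hT.2 i h1 (by omega)⟩⟩⟩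
        rintro rfl
        exact h ⟨h1, h2⟩
      -- If `p ≠ M` came last, pit `M` was already occupied, so ball `m` chose uniformly among `n -
      -- m` pits and was displaced.
      have hp : ∀ p ∈ T.erase M, stepPoly k hm (T.erase p) p *
          occupationPoly k n m (Nat.le_of_succ_le hm) (T.erase p) =
          if ¬ (k ≤ (p : ℕ) ∧ (p : ℕ) < m + 1) then C ((n - m : ℕ) : ℝ)⁻¹ * X * R else 0 := by
        intro p hp
        obtain ⟨hpM, hpT⟩ := Finset.mem_erase.1 hp
        have hpm : (p : ℕ) ≠ m := fun h => hpM (Fin.ext h)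
        rw [stepPoly_other hkm (Finset.mem_erase.2 ⟨hpM.symm, hMT⟩) (Finset.notMem_erase _ _)
          (hcard p hpT), ih, mul_ite, mul_zero]
        refine if_congr ((hocc p hpT).trans ?_) rfl rfl
        omega
      have hfilter : ((T.erase M).filter fun p : Fin n => ¬ (k ≤ (p : ℕ) ∧ (p : ℕ) < m + 1)) =
          T.filter fun p : Fin n => ¬ (k ≤ (p : ℕ) ∧ (p : ℕ) < m + 1) := by
        ext p
        simp only [Finset.mem_filter, Finset.mem_erase]
        refine ⟨fun h => ⟨h.1.2, h.2⟩, fun h => ⟨⟨?_, h.1⟩, h.2⟩⟩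
        rintro rfl
        exact h.2 ⟨hkm, Nat.lt_succ_self m⟩
      rw [if_pos hT, ← Finset.add_sum_erase _ _ hMT, stepPoly_own hkm (Finset.notMem_erase _ _),
        ih, if_pos ((hocc M hMT).2 fun h => lt_irrefl _ h.2), Finset.sum_congr rfl hp,
        ← Finset.sum_filter, hfilter, Finset.sum_const, hT.card_filter (by omega) hm,
        Finset.prod_Ico_succ_top hkm, nsmul_eq_mul, div_eq_mul_inv, C_mul, C_eq_natCast, hR]
      ring
    · rw [if_neg hT]
      refine Finset.sum_eq_zero fun p hp => ?_
      by_cases hocc : IsOccupied k m (T.erase p)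
      · have hMT : M ∉ T := by
          refine fun h => hT ⟨by rw [← Finset.card_erase_add_one hp, hocc.1], fun i h1 h2 => ?_⟩
          rcases Nat.lt_succ_iff_lt_or_eq.1 h2 with h3 | h3
          · exact Finset.mem_of_mem_erase (hocc.2 i h1 h3)
          · rwa [show i = M from Fin.ext h3]
        rw [stepPoly_eq_zero, zero_mul]
        rw [choicesOf, if_pos ⟨hkm, fun h => hMT (Finset.mem_of_mem_erase h)⟩,
          Finset.mem_singleton]
        rintro rfl
        exact hMT hp
      · rw [ih, if_neg hocc, mul_zero]

/-! ### Bernoulli product for the displaced balls -/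

/-- The number of balls other than the first `k` that do not meet their assigned pit. -/
def misplacedFrom (k n : ℕ) (f : Fin n → Fin n) : ℕ :=
  ∑ i : Fin n, if k ≤ (i : ℕ) ∧ f i ≠ i then 1 else 0

open Polynomial in
theorem sum_misplacedFrom_eq_C_mul_prod (k n : ℕ) (hkn : k ≤ n) :
    ∃ c : ℝ, ∑ f, C (partialPlacementLaw k n n le_rfl f).toReal * X ^ misplacedFrom k n f =
      C c * ∏ j ∈ Finset.Ico k n, (1 + C ((k : ℝ) / (n - j : ℕ)) * X) := by
  classical
  obtain ⟨c, hc⟩ := exists_occupationPoly_of_ge k n hkn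
  refine ⟨c, ?_⟩
  have h := hc n le_rfl hkn
  have h2 : ∑ T, occupationPoly k n n le_rfl T =
      ∑ f, C (partialPlacementLaw k n n le_rfl f).toReal * X ^ misplacedFrom k n f := by
    simp only [occupationPoly]
    rw [Finset.sum_comm]
    refine Finset.sum_congr rfl fun f _ => ?_
    rw [Finset.sum_ite_eq, if_pos (Finset.mem_univ _)]
    simp [misplacedFrom, Fin.ext_iff]
  rw [← h2, Finset.sum_eq_single Finset.univ, h, if_pos ⟨by simp, fun i _ _ => Finset.mem_univ i⟩]
  · intro T _ hT
    rw [h, if_neg]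
    exact fun h' => hT (Finset.card_eq_iff_eq_univ T |>.1 (by simpa using h'.1))
  · simp

theorem sum_partialPlacementLaw (k n m : ℕ) (hm : m ≤ n) :
    ∑ f, (partialPlacementLaw k n m hm f).toReal = 1 := by
  rw [← ENNReal.toReal_sum fun f _ => PMF.apply_ne_top _ f, ← tsum_fintype (L := .unconditional _),
    PMF.tsum_coe, ENNReal.toReal_one]

-- The unknown constant is eliminated by evaluating at `1`, where the total mass is `1`. With `r = n
-- - j`, each factor is `1 + k / r` times the Bernoulli polynomial of parameter `k / (r + k)`, and
-- `s = r + k` runs over `k + 1, …, n`.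
open Polynomial in
theorem sum_misplacedFrom_eq_prod (k n : ℕ) (hkn : k ≤ n) :
    ∑ f, C (partialPlacementLaw k n n le_rfl f).toReal * X ^ misplacedFrom k n f =
      ∏ s ∈ Finset.Ioc k n, (C (1 - (k : ℝ) / s) + C ((k : ℝ) / s) * X) := by
  obtain ⟨c, hc⟩ := sum_misplacedFrom_eq_C_mul_prod k n hkn
  have h1 := congrArg (eval 1) hc
  simp only [eval_finsetSum, eval_mul, eval_C, eval_pow, eval_X, one_pow, mul_one, eval_prod,
    eval_add, eval_one, sum_partialPlacementLaw] at h1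
  have hreindex : ∏ s ∈ Finset.Ioc k n, (C (1 - (k : ℝ) / s) + C ((k : ℝ) / s) * X) =
      ∏ j ∈ Finset.Ico k n, (C (1 - (k : ℝ) / (n + k - j : ℕ)) +
        C ((k : ℝ) / (n + k - j : ℕ)) * X) := by
    refine Finset.prod_nbij' (fun s => n + k - s) (fun j => n + k - j) ?_ ?_ ?_ ?_ ?_
    · intro s hs; simp only [Finset.mem_Ioc, Finset.mem_Ico] at hs ⊢; omega
    · intro s hs; simp only [Finset.mem_Ioc, Finset.mem_Ico] at hs ⊢; omega
    · intro s hs; simp only [Finset.mem_Ioc] at hs; omega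
    · intro s hs; simp only [Finset.mem_Ico] at hs; omega
    · intro s hs
      simp only [Finset.mem_Ioc] at hs
      rw [show n + k - (n + k - s) = s by omega]
  have hfactor : ∀ j ∈ Finset.Ico k n, 1 + C ((k : ℝ) / (n - j : ℕ)) * X =
      C (1 + (k : ℝ) / (n - j : ℕ)) * (C (1 - (k : ℝ) / (n + k - j : ℕ)) +
        C ((k : ℝ) / (n + k - j : ℕ)) * X) := by
    intro j hj
    rw [Finset.mem_Ico] at hj
    rw [show n + k - j = (n - j) + k by omega]
    have hr : (0 : ℝ) < (n - j : ℕ) := by exact_mod_cast Nat.sub_pos_of_lt hj.2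
    push_cast [-Nat.cast_sub]
    generalize ((n - j : ℕ) : ℝ) = r at hr
    have hrk : r + k ≠ 0 := by positivity
    rw [mul_add, ← mul_assoc, ← C_mul, ← C_mul, ← C_1]
    congr 3
    · field_simp
      ring
    · field_simp
  rw [hc, hreindex, Finset.prod_congr rfl hfactor, Finset.prod_mul_distrib, ← mul_assoc,
    ← map_prod, ← C_mul, ← h1, C_1, one_mul]

/-! ### Exact mean and variance -/

open Polynomial in
theorem eval_one_prod_bernoulli {ι : Type*} (s : Finset ι) (p : ι → ℝ) :
    eval 1 (∏ i ∈ s, (C (1 - p i) + C (p i) * X)) = 1 := by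
  simp [eval_prod]

open Polynomial in
theorem eval_one_derivative_prod_bernoulli {ι : Type*} (s : Finset ι) (p : ι → ℝ) :
    eval 1 (derivative (∏ i ∈ s, (C (1 - p i) + C (p i) * X))) = ∑ i ∈ s, p i := by
  classical
  induction s using Finset.induction_on with
  | empty => simp
  | insert a s ha ih =>
    rw [Finset.prod_insert ha, Finset.sum_insert ha, derivative_mul, eval_add, eval_mul, eval_mul,
      ih, eval_one_prod_bernoulli]
    simp

open Polynomial in
theorem eval_one_derivative_derivative_prod_bernoulli {ι : Type*} (s : Finset ι) (p : ι → ℝ) :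
    eval 1 (derivative (derivative (∏ i ∈ s, (C (1 - p i) + C (p i) * X)))) =
      (∑ i ∈ s, p i) ^ 2 - ∑ i ∈ s, p i ^ 2 := by
  classical
  induction s using Finset.induction_on with
  | empty => simp
  | insert a s ha ih =>
    rw [Finset.prod_insert ha, Finset.sum_insert ha, Finset.sum_insert ha, derivative_mul,
      derivative_add, derivative_mul, derivative_mul]
    simp only [eval_add, eval_mul, ih, eval_one_prod_bernoulli, eval_one_derivative_prod_bernoulli]
    simp
    ring

theorem integral_placementMeasure {E : Type*} [NormedAddCommGroup E] [NormedSpace ℝ E]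
    [CompleteSpace E] (k n : ℕ) (g : (Fin n → Fin n) → E) :
    ∫ N, g N ∂(placementMeasure k n) = ∑ f, (partialPlacementLaw k n n le_rfl f).toReal • g f :=
  PMF.integral_eq_sum _ _

open Polynomial in
theorem integral_misplacedFrom (k n : ℕ) (hkn : k ≤ n) :
    ∫ N, (misplacedFrom k n N : ℝ) ∂(placementMeasure k n) = ∑ s ∈ Finset.Ioc k n, (k : ℝ) / s := by
  rw [← eval_one_derivative_prod_bernoulli, integral_placementMeasure,
    ← sum_misplacedFrom_eq_prod k n hkn]
  simp only [derivative_sum, derivative_C_mul_X_pow, eval_finsetSum, eval_mul, eval_C, eval_pow,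
    eval_X, one_pow, mul_one, smul_eq_mul]

open Polynomial in
theorem integral_misplacedFrom_sq (k n : ℕ) (hkn : k ≤ n) :
    ∫ N, (misplacedFrom k n N : ℝ) ^ 2 ∂(placementMeasure k n) =
      (∑ s ∈ Finset.Ioc k n, (k : ℝ) / s) ^ 2 - ∑ s ∈ Finset.Ioc k n, ((k : ℝ) / s) ^ 2 +
        ∑ s ∈ Finset.Ioc k n, (k : ℝ) / s := by
  rw [← eval_one_derivative_derivative_prod_bernoulli, ← integral_misplacedFrom k n hkn,
    integral_placementMeasure, integral_placementMeasure, ← sum_misplacedFrom_eq_prod k n hkn]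
  simp only [derivative_sum, derivative_C_mul_X_pow, eval_finsetSum, eval_mul, eval_C, eval_pow,
    eval_X, one_pow, mul_one, smul_eq_mul]
  rw [← Finset.sum_add_distrib]
  refine Finset.sum_congr rfl fun f _ => ?_
  -- The second derivative yields `m * (m - 1)` with truncated subtraction, hence the separate case
  -- `0`.
  rcases misplacedFrom k n f with _ | m
  · simp
  · rw [Nat.add_sub_cancel]
    push_cast
    ring

theorem memLp_placementMeasure (k n : ℕ) (g : (Fin n → Fin n) → ℝ) (q : ENNReal) :
    MemLp g q (placementMeasure k n) :=
  .of_discrete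

theorem variance_misplacedFrom (k n : ℕ) (hkn : k ≤ n) :
    variance (fun N => (misplacedFrom k n N : ℝ)) (placementMeasure k n) =
      ∑ s ∈ Finset.Ioc k n, (k : ℝ) / s - ∑ s ∈ Finset.Ioc k n, ((k : ℝ) / s) ^ 2 := by
  rw [variance_eq_sub (memLp_placementMeasure k n _ 2)]
  simp only [Pi.pow_apply]
  rw [integral_misplacedFrom_sq k n hkn, integral_misplacedFrom k n hkn]
  ring

/-! ### Comparison of the counts and asymptotics of the moments -/

theorem misplacedFrom_le_misplaced (k n : ℕ) (f : Fin n → Fin n) :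
    misplacedFrom k n f ≤ misplaced n f := by
  refine Finset.sum_le_sum fun i _ => ?_
  by_cases h : f i = i <;> simp [h]
  split_ifs <;> simp

theorem misplaced_le_misplacedFrom_add (k n : ℕ) (f : Fin n → Fin n) :
    misplaced n f ≤ misplacedFrom k n f + k := by
  have h1 : ∑ i : Fin n, (if (i : ℕ) < k then 1 else 0) ≤ k := by
    rw [← Finset.card_filter, ← Finset.card_map Fin.valEmbedding]
    refine (Finset.card_le_card fun i hi => ?_).trans (Finset.card_range k).le
    obtain ⟨j, hj, rfl⟩ := Finset.mem_map.1 hi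
    exact Finset.mem_range.2 (Finset.mem_filter.1 hj).2
  refine le_trans ?_ (Nat.add_le_add_left h1 _)
  rw [misplacedFrom, ← Finset.sum_add_distrib]
  refine Finset.sum_le_sum fun i _ => ?_
  by_cases h : f i = i <;> by_cases h' : (i : ℕ) < k
  all_goals simp [h, h', not_le, not_lt.1]

theorem abs_sum_div_sub_mul_log_le (k n : ℕ) (hkn : k ≤ n) :
    |∑ s ∈ Finset.Ioc k n, (k : ℝ) / s - k * Real.log n| ≤ k * (1 + harmonic k) := by
  have hcons := Finset.sum_Ioc_consecutive (fun s : ℕ => ((s : ℚ))⁻¹) (Nat.zero_le k) hkn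
  have hH : ∀ m : ℕ, harmonic m = ∑ s ∈ Finset.Ioc 0 m, ((s : ℚ))⁻¹ := fun m => by
    rw [harmonic_eq_sum_Icc]; rfl
  have hsum : ∑ s ∈ Finset.Ioc k n, (k : ℝ) / s = k * ((harmonic n : ℝ) - harmonic k) := by
    rw [← hH, ← hH] at hcons
    rw [← hcons]
    push_cast
    rw [add_sub_cancel_left, Finset.mul_sum]
    simp only [div_eq_mul_inv]
  have h1 := harmonic_le_one_add_log n
  have h2 := log_add_one_le_harmonic n
  have h3 : Real.log n ≤ Real.log (n + 1 : ℕ) := by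
    rcases Nat.eq_zero_or_pos n with rfl | hn
    · simp
    · exact Real.log_le_log (by exact_mod_cast hn) (by push_cast; linarith)
  have h4 : (0 : ℝ) ≤ harmonic k := by
    rw [hH]; push_cast; exact Finset.sum_nonneg fun i _ => by positivity
  rw [hsum, ← mul_sub, abs_mul, Nat.abs_cast]
  refine mul_le_mul_of_nonneg_left ?_ (Nat.cast_nonneg k)
  rw [abs_le]
  constructor <;> linarith

theorem exists_sum_div_sq_le (k : ℕ) :
    ∃ B : ℝ, 0 ≤ B ∧ ∀ n, ∑ s ∈ Finset.Ioc k n, ((k : ℝ) / s) ^ 2 ≤ B := by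
  have hs : Summable fun s : ℕ => ((k : ℝ) / s) ^ 2 := by
    simp only [div_pow]
    simp only [div_eq_mul_inv]
    exact (Real.summable_nat_pow_inv.2 one_lt_two).mul_left _
  exact ⟨∑' s : ℕ, ((k : ℝ) / s) ^ 2, tsum_nonneg fun _ => by positivity,
    fun n => hs.sum_le_tsum _ fun _ _ => by positivity⟩

/-- Nonnegativity of the variances of `a • X ± Y`, divided by `a`, bounds twice the covariance; this
is Cauchy–Schwarz with a free weight `a`. -/
theorem abs_variance_add_sub_le {Ω : Type*} [MeasurableSpace Ω] {μ : Measure Ω}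
    [IsProbabilityMeasure μ] {X Y : Ω → ℝ} (hX : MemLp X 2 μ) (hY : MemLp Y 2 μ) {a K : ℝ}
    (ha : 0 < a) (hYK : variance Y μ ≤ K) :
    |variance (X + Y) μ - variance X μ| ≤ a * variance X μ + K + K / a := by
  have h1 := variance_nonneg (a • X + Y) μ
  have h2 := variance_nonneg (a • X - Y) μ
  rw [variance_add (hX.const_smul a) hY, variance_smul, covariance_smul_left] at h1
  rw [variance_sub (hX.const_smul a) hY, variance_smul, covariance_smul_left] at h2
  have hYa : variance Y μ / a ≤ K / a := by gcongr
  have hY0 := variance_nonneg Y μ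
  have e : a * (variance Y μ / a) = variance Y μ := by field_simp
  rw [variance_add hX hY, abs_le]
  constructor
  · have : 0 ≤ a * (a * variance X μ + 2 * covariance X Y μ + variance Y μ / a) := by nlinarith
    have := nonneg_of_mul_nonneg_right this ha
    linarith
  · have : 0 ≤ a * (a * variance X μ - 2 * covariance X Y μ + variance Y μ / a) := by nlinarith
    have := nonneg_of_mul_nonneg_right this ha
    linarith

theorem tendsto_mul_log_atTop {k : ℕ} (hk : 1 ≤ k) :
    Tendsto (fun n : ℕ => (k : ℝ) * Real.log n) atTop atTop :=
  (Real.tendsto_log_atTop.comp tendsto_natCast_atTop_atTop).const_mul_atTop (by exact_mod_cast hk)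

theorem tendsto_div_one_of_abs_sub_le {u L : ℕ → ℝ} {A : ℝ} (hL : Tendsto L atTop atTop)
    (h : ∀ᶠ n in atTop, |u n - L n| ≤ A * √(L n)) :
    Tendsto (fun n => u n / L n) atTop (𝓝 1) := by
  rw [tendsto_iff_norm_sub_tendsto_zero]
  have hs : Tendsto (fun n => A / √(L n)) atTop (𝓝 0) :=
    (Real.tendsto_sqrt_atTop.comp hL).const_div_atTop A
  refine squeeze_zero' (.of_forall fun _ => norm_nonneg _) ?_ hs
  filter_upwards [h, hL.eventually_gt_atTop 0] with n hn hpos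
  rw [div_sub_one hpos.ne', norm_div, Real.norm_eq_abs, Real.norm_eq_abs, abs_of_pos hpos,
    div_le_div_iff₀ hpos (Real.sqrt_pos.2 hpos)]
  calc |u n - L n| * √(L n) ≤ A * √(L n) * √(L n) := by gcongr
    _ = A * L n := by rw [mul_assoc, Real.mul_self_sqrt hpos.le]

theorem tendsto_integral_misplaced {k : ℕ} (hk : 1 ≤ k) :
    Tendsto (fun n : ℕ => (∫ N, (misplaced n N : ℝ) ∂(placementMeasure k n)) / (k * Real.log n))
      atTop (𝓝 1) := by
  refine tendsto_div_one_of_abs_sub_le (A := k + k * (1 + harmonic k)) (tendsto_mul_log_atTop hk) ?_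
  filter_upwards [eventually_ge_atTop k, (tendsto_mul_log_atTop hk).eventually_ge_atTop 1]
    with n hkn hL
  have h1 := abs_le.1 (abs_sum_div_sub_mul_log_le k n hkn)
  rw [← integral_misplacedFrom k n hkn] at h1
  have h2 : ∫ N, (misplacedFrom k n N : ℝ) ∂(placementMeasure k n) ≤
      ∫ N, (misplaced n N : ℝ) ∂(placementMeasure k n) :=
    integral_mono .of_finite .of_finite
      fun N => Nat.cast_le.2 (misplacedFrom_le_misplaced k n N)
  have h3 : ∫ N, (misplaced n N : ℝ) ∂(placementMeasure k n) ≤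
      ∫ N, (misplacedFrom k n N : ℝ) ∂(placementMeasure k n) + k := by
    calc _ ≤ ∫ N, ((misplacedFrom k n N : ℝ) + k) ∂(placementMeasure k n) :=
          integral_mono .of_finite .of_finite
            fun N => (Nat.cast_le.2 (misplaced_le_misplacedFrom_add k n N)).trans_eq
              (Nat.cast_add _ _)
      _ = _ := by rw [integral_add .of_finite .of_finite, integral_const]; simp
  have hk0 : (0 : ℝ) ≤ k := Nat.cast_nonneg k
  have h4 := abs_le.2 (show -(k + k * (1 + harmonic k) : ℝ) ≤
    (∫ N, (misplaced n N : ℝ) ∂(placementMeasure k n)) - k * Real.log n ∧ _ ≤ _ from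
    ⟨by linarith [h1.1], by linarith [h1.2]⟩)
  exact h4.trans (le_mul_of_one_le_right ((abs_nonneg _).trans h4) (Real.one_le_sqrt.2 hL))

theorem tendsto_variance_misplaced {k : ℕ} (hk : 1 ≤ k) :
    Tendsto (fun n : ℕ => variance (fun N => (misplaced n N : ℝ)) (placementMeasure k n) /
        (k * Real.log n)) atTop (𝓝 1) := by
  obtain ⟨B, hB0, hB⟩ := exists_sum_div_sq_le k
  set A : ℝ := k * (1 + harmonic k) + B with hA
  refine tendsto_div_one_of_abs_sub_le (A := 2 * A + 1 + 2 * (k : ℝ) ^ 2)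
    (tendsto_mul_log_atTop hk) ?_
  filter_upwards [eventually_ge_atTop k, (tendsto_mul_log_atTop hk).eventually_ge_atTop 1]
    with n hkn hL
  set μ := placementMeasure k n
  set L := (k : ℝ) * Real.log n with hLdef
  set X : (Fin n → Fin n) → ℝ := fun N => misplacedFrom k n N
  set Y : (Fin n → Fin n) → ℝ := fun N => (misplaced n N : ℝ) - misplacedFrom k n N
  have hXY : (fun N => (misplaced n N : ℝ)) = X + Y := by
    ext N; simp [X, Y]
  have hXvar : |variance X μ - L| ≤ A := by
    rw [variance_misplacedFrom k n hkn]
    have h1 := abs_le.1 (abs_sum_div_sub_mul_log_le k n hkn)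
    have h2 := hB n
    have h3 : 0 ≤ ∑ s ∈ Finset.Ioc k n, ((k : ℝ) / s) ^ 2 :=
      Finset.sum_nonneg fun _ _ => by positivity
    rw [abs_le]
    constructor <;> linarith [h1.1, h1.2]
  have hYbd : ∀ N, Y N ∈ Set.Icc (0 : ℝ) k := fun N => by
    have h1 : (misplacedFrom k n N : ℝ) ≤ misplaced n N := by
      exact_mod_cast misplacedFrom_le_misplaced k n N
    have h2 : (misplaced n N : ℝ) ≤ misplacedFrom k n N + k := by
      exact_mod_cast misplaced_le_misplacedFrom_add k n N
    exact ⟨sub_nonneg.2 h1, by simp only [Y]; linarith⟩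
  have hYvar : variance Y μ ≤ (k : ℝ) ^ 2 := by
    have := variance_le_sq_of_bounded (μ := μ) (.of_forall hYbd) Measurable.of_discrete.aemeasurable
    refine this.trans ?_
    nlinarith [sq_nonneg (k : ℝ)]
  have hL1 : 1 ≤ √L := Real.one_le_sqrt.2 hL
  have hLs : √L * √L = L := Real.mul_self_sqrt (by linarith)
  -- The weight `1 / √L` balances `a * L` against `1 / a`, making both of order `√L`.
  have hvar := abs_variance_add_sub_le (memLp_placementMeasure k n X 2)
    (memLp_placementMeasure k n Y 2) (a := (√L)⁻¹) (by positivity) hYvar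
  rw [← hXY, div_inv_eq_mul] at hvar
  have hXle : (√L)⁻¹ * variance X μ ≤ √L + A := by
    have hA0 : 0 ≤ A := (abs_nonneg _).trans hXvar
    rw [inv_mul_le_iff₀ (by positivity)]
    nlinarith [(abs_le.1 hXvar).2]
  have hA0 : 0 ≤ A := (abs_nonneg _).trans hXvar
  calc |variance (fun N => (misplaced n N : ℝ)) μ - L|
      ≤ |variance (fun N => (misplaced n N : ℝ)) μ - variance X μ| + |variance X μ - L| :=
        abs_sub_le _ _ _
    _ ≤ (√L + A + (k : ℝ) ^ 2 + (k : ℝ) ^ 2 * √L) + A := by linarith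
    _ ≤ (2 * A + 1 + 2 * (k : ℝ) ^ 2) * √L := by
        nlinarith [mul_nonneg hA0 (sub_nonneg.2 hL1), mul_nonneg (sq_nonneg (k : ℝ)) (sub_nonneg.2 hL1)]

/-! ### Poisson approximation and the limiting characteristic function -/

theorem norm_prod_sub_prod_le_of_norm_le_one {ι : Type*} (s : Finset ι) {a b : ι → ℂ}
    (ha : ∀ i ∈ s, ‖a i‖ ≤ 1) (hb : ∀ i ∈ s, ‖b i‖ ≤ 1) :
    ‖∏ i ∈ s, a i - ∏ i ∈ s, b i‖ ≤ ∑ i ∈ s, ‖a i - b i‖ := by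
  classical
  induction s using Finset.induction_on with
  | empty => simp
  | insert j s hj ih =>
    rw [Finset.forall_mem_insert] at ha hb
    rw [Finset.prod_insert hj, Finset.prod_insert hj, Finset.sum_insert hj,
      show a j * ∏ i ∈ s, a i - b j * ∏ i ∈ s, b i =
        (a j - b j) * ∏ i ∈ s, a i + b j * (∏ i ∈ s, a i - ∏ i ∈ s, b i) by ring]
    have h1 : ‖∏ i ∈ s, a i‖ ≤ 1 := by
      rw [norm_prod]
      exact Finset.prod_le_one (fun _ _ => norm_nonneg _) ha.2
    refine (norm_add_le _ _).trans (add_le_add ?_ ?_)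
    · rw [norm_mul]
      exact mul_le_of_le_one_right (norm_nonneg _) h1
    · rw [norm_mul]
      exact (mul_le_of_le_one_left (norm_nonneg _) hb.1).trans (ih ha.2 hb.2)

/-- Poisson approximation of the characteristic function of a sum of independent Bernoulli
variables. -/
theorem norm_prod_bernoulli_sub_exp_le {ι : Type*} (s : Finset ι) {p : ι → ℝ}
    (hp0 : ∀ i ∈ s, 0 ≤ p i) (hp1 : ∀ i ∈ s, p i ≤ 1) {θ : ℝ} (hθ : |θ| ≤ 1) :
    ‖∏ i ∈ s, (1 - p i + p i * Complex.exp (θ * Complex.I)) -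
      Complex.exp ((∑ i ∈ s, p i : ℝ) * (Complex.exp (θ * Complex.I) - 1))‖ ≤
      (∑ i ∈ s, p i ^ 2) * θ ^ 2 := by
  set u := Complex.exp (θ * Complex.I) - 1 with hu
  have hunorm : ‖u‖ ≤ |θ| := by
    rw [hu, mul_comm]
    exact Real.norm_exp_I_mul_ofReal_sub_one_le
  have hure : u.re ≤ 0 := by
    rw [hu, Complex.sub_re, Complex.exp_ofReal_mul_I_re, Complex.one_re]
    linarith [Real.cos_le_one θ]
  have hexp : Complex.exp ((∑ i ∈ s, p i : ℝ) * u) = ∏ i ∈ s, Complex.exp (p i * u) := by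
    rw [Complex.ofReal_sum, Finset.sum_mul, Complex.exp_sum]
  rw [hexp, Finset.sum_mul]
  refine (norm_prod_sub_prod_le_of_norm_le_one s ?_ ?_).trans (Finset.sum_le_sum fun i hi => ?_)
  · intro i hi
    refine (norm_add_le _ _).trans ?_
    rw [norm_mul, Complex.norm_exp_ofReal_mul_I, ← Complex.ofReal_one, ← Complex.ofReal_sub,
      Complex.norm_real, Complex.norm_real, Real.norm_of_nonneg (sub_nonneg.2 (hp1 i hi)),
      Real.norm_of_nonneg (hp0 i hi)]
    linarith
  · intro i hi
    rw [Complex.norm_exp, Complex.re_ofReal_mul]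
    exact Real.exp_le_one_iff.2 (mul_nonpos_of_nonneg_of_nonpos (hp0 i hi) hure)
  · have hpu : ‖(p i : ℂ) * u‖ ≤ p i * |θ| := by
      rw [norm_mul, Complex.norm_real, Real.norm_of_nonneg (hp0 i hi)]
      exact mul_le_mul_of_nonneg_left hunorm (hp0 i hi)
    have hpu1 : ‖(p i : ℂ) * u‖ ≤ 1 :=
      hpu.trans (mul_le_one₀ (hp1 i hi) (abs_nonneg _) hθ)
    rw [norm_sub_rev, show Complex.exp (p i * u) - (1 - p i + p i * Complex.exp (θ * Complex.I)) =
      Complex.exp (p i * u) - 1 - p i * u by rw [hu]; ring]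
    -- The Bernoulli factor is `1 + p i * u`, the first-order expansion of the Poisson factor `exp
    -- (p i * u)`.
    refine (Complex.norm_exp_sub_one_sub_id_le hpu1).trans ?_
    calc ‖(p i : ℂ) * u‖ ^ 2 ≤ (p i * |θ|) ^ 2 := by gcongr
      _ = p i ^ 2 * θ ^ 2 := by rw [mul_pow, sq_abs]

/-- The characteristic function of a normalised Poisson variable tends to that of the standard
normal distribution. -/
theorem tendsto_exp_poisson {L l : ℕ → ℝ} {A : ℝ} (hL : Tendsto L atTop atTop)
    (hl : ∀ᶠ n in atTop, |l n - L n| ≤ A) (t : ℝ) :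
    Tendsto (fun n => Complex.exp (-((t / √(L n) : ℝ) * L n * Complex.I)) *
      Complex.exp (l n * (Complex.exp ((t / √(L n) : ℝ) * Complex.I) - 1))) atTop
      (𝓝 (Complex.exp (-(t : ℂ) ^ 2 / 2))) := by
  set θ : ℕ → ℝ := fun n => t / √(L n) with hθ
  have hθ0 : Tendsto θ atTop (𝓝 0) := (Real.tendsto_sqrt_atTop.comp hL).const_div_atTop t
  have hLθ : ∀ᶠ n in atTop, L n * θ n ^ 2 = t ^ 2 := by
    filter_upwards [hL.eventually_gt_atTop 0] with n hn
    rw [hθ, div_pow, Real.sq_sqrt hn.le]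
    field_simp
  have hdiff : Tendsto (fun n => (l n - L n) * θ n) atTop (𝓝 0) :=
    bdd_le_mul_tendsto_zero' A hl hθ0
  have hlθ : Tendsto (fun n => l n * θ n ^ 2) atTop (𝓝 (t ^ 2)) := by
    have h1 := (hdiff.mul hθ0).add_const (t ^ 2)
    rw [zero_mul, zero_add] at h1
    refine h1.congr' ?_
    filter_upwards [hLθ] with n hn
    rw [← hn]
    ring
  have hrem : Tendsto (fun n => (l n : ℂ) * (Complex.exp (θ n * Complex.I) - 1 - θ n * Complex.I -
      (θ n * Complex.I) ^ 2 / 2)) atTop (𝓝 0) := by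
    have hz : Tendsto (fun n => |l n * θ n ^ 2| * |θ n|) atTop (𝓝 0) := by
      simpa using hlθ.abs.mul hθ0.abs
    refine squeeze_zero_norm' ?_ hz
    filter_upwards [hθ0.abs.eventually_le_const (show |(0 : ℝ)| < 1 by simp)] with n hn
    have hx : ‖(θ n : ℂ) * Complex.I‖ = |θ n| := by simp
    have hb := Complex.exp_bound (x := θ n * Complex.I) (hx.trans_le hn) (n := 3) (by norm_num)
    rw [hx] at hb
    simp only [Finset.sum_range_succ, Finset.sum_range_zero, Nat.factorial] at hb
    norm_num at hb
    rw [norm_mul, Complex.norm_real, Real.norm_eq_abs, abs_mul, abs_pow, mul_assoc, ← pow_succ]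
    refine mul_le_mul_of_nonneg_left ?_ (abs_nonneg _)
    rw [show Complex.exp (θ n * Complex.I) - 1 - θ n * Complex.I - (θ n * Complex.I) ^ 2 / 2 =
      Complex.exp (θ n * Complex.I) - (1 + θ n * Complex.I + (θ n * Complex.I) ^ 2 / 2) by ring]
    refine hb.trans ?_
    nlinarith [pow_nonneg (abs_nonneg (θ n)) 3]
  -- The exponent is the cubic Taylor remainder plus `(l - L) * θ * I` minus `l * θ ^ 2 / 2`; the
  -- first two vanish in the limit.
  have hexp := ((hrem.add ((Complex.continuous_ofReal.tendsto _).comp hdiff |>.mul_const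
    Complex.I)).sub (((Complex.continuous_ofReal.tendsto _).comp hlθ).div_const 2)).cexp
  have hlim : (0 + ((0 : ℝ) : ℂ) * Complex.I - ((t ^ 2 : ℝ) : ℂ) / 2) = -(t : ℂ) ^ 2 / 2 := by
    push_cast; ring
  rw [hlim] at hexp
  refine hexp.congr fun n => ?_
  rw [← Complex.exp_add]
  change _ = Complex.exp (-((θ n : ℝ) * L n * Complex.I) + l n * (Complex.exp (θ n * Complex.I) - 1))
  congr 1
  simp only [Function.comp_apply]
  push_cast
  rw [mul_pow, Complex.I_sq]
  ring

open Polynomial in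
theorem integral_exp_misplacedFrom (k n : ℕ) (hkn : k ≤ n) (θ : ℝ) :
    ∫ N, Complex.exp (θ * (misplacedFrom k n N : ℝ) * Complex.I) ∂(placementMeasure k n) =
      ∏ s ∈ Finset.Ioc k n, (1 - ((k : ℝ) / s : ℝ) +
        ((k : ℝ) / s : ℝ) * Complex.exp (θ * Complex.I)) := by
  have h := congrArg (eval₂ Complex.ofRealHom (Complex.exp (θ * Complex.I)))
    (sum_misplacedFrom_eq_prod k n hkn)
  simp only [eval₂_finsetSum, eval₂_finsetProd, eval₂_add, eval₂_mul, eval₂_C, eval₂_X_pow,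
    eval₂_X, Complex.ofRealHom_eq_coe, Complex.ofReal_sub, Complex.ofReal_one] at h
  rw [← h, integral_placementMeasure]
  refine Finset.sum_congr rfl fun f _ => ?_
  rw [Complex.real_smul, ← Complex.exp_nat_mul]
  congr 2
  push_cast
  ring

/-- The two counts differ by at most `k` pointwise and `x ↦ exp (I * θ * x)` is `|θ|`-Lipschitz, so
passing to `misplacedFrom` costs nothing as `θ → 0`. -/
theorem norm_integral_exp_misplaced_sub_le (k n : ℕ) (θ L : ℝ) :
    ‖∫ N, Complex.exp (θ * ((misplaced n N : ℝ) - L : ℝ) * Complex.I) ∂(placementMeasure k n) -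
      Complex.exp (-(θ * L * Complex.I)) *
      ∫ N, Complex.exp (θ * (misplacedFrom k n N : ℝ) * Complex.I) ∂(placementMeasure k n)‖ ≤
      |θ| * k := by
  rw [← integral_const_mul, ← integral_sub .of_finite .of_finite]
  refine (norm_integral_le_of_norm_le_const (.of_forall fun N => ?_)).trans_eq
    (by rw [probReal_univ, mul_one])
  have h1 : (misplacedFrom k n N : ℝ) ≤ misplaced n N :=
    Nat.cast_le.2 (misplacedFrom_le_misplaced k n N)
  have h2 : (misplaced n N : ℝ) ≤ misplacedFrom k n N + k := by
    exact_mod_cast misplaced_le_misplacedFrom_add k n N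
  set W : ℝ := (misplaced n N : ℝ)
  set S : ℝ := (misplacedFrom k n N : ℝ)
  have h3 : Complex.exp (θ * (W - L : ℝ) * Complex.I) -
      Complex.exp (-(θ * L * Complex.I)) * Complex.exp (θ * S * Complex.I) =
      Complex.exp ((θ * (S - L) : ℝ) * Complex.I) *
        (Complex.exp (Complex.I * (θ * (W - S) : ℝ)) - 1) := by
    rw [mul_sub, ← Complex.exp_add, ← Complex.exp_add, mul_one]
    congr 2 <;> push_cast <;> ring
  rw [h3, norm_mul, Complex.norm_exp_ofReal_mul_I, one_mul]
  refine Real.norm_exp_I_mul_ofReal_sub_one_le.trans ?_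
  rw [Real.norm_eq_abs, abs_mul, abs_of_nonneg (sub_nonneg.2 h1)]
  exact mul_le_mul_of_nonneg_left (by linarith) (abs_nonneg _)

theorem tendsto_integral_exp_misplaced {k : ℕ} (hk : 1 ≤ k) (t : ℝ) :
    Tendsto (fun n : ℕ => ∫ N, Complex.exp ((t / √(k * Real.log n) : ℝ) *
      ((misplaced n N : ℝ) - k * Real.log n : ℝ) * Complex.I) ∂(placementMeasure k n)) atTop
      (𝓝 (Complex.exp (-(t : ℂ) ^ 2 / 2))) := by
  have hL := tendsto_mul_log_atTop hk
  set L : ℕ → ℝ := fun n => k * Real.log n with hLdef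
  set l : ℕ → ℝ := fun n => ∑ s ∈ Finset.Ioc k n, (k : ℝ) / s with hl
  obtain ⟨B, hB0, hB⟩ := exists_sum_div_sq_le k
  have hpois := tendsto_exp_poisson (l := l) hL ((eventually_ge_atTop k).mono fun n hn =>
    abs_sum_div_sub_mul_log_le k n hn) t
  set θ : ℕ → ℝ := fun n => t / √(L n) with hθ
  have hθ0 : Tendsto θ atTop (𝓝 0) := (Real.tendsto_sqrt_atTop.comp hL).const_div_atTop t
  have herr : Tendsto (fun n => |θ n| * k + B * θ n ^ 2) atTop (𝓝 0) := by
    simpa using (hθ0.abs.mul_const (k : ℝ)).add ((hθ0.pow 2).const_mul B)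
  refine tendsto_of_tendsto_of_dist hpois (squeeze_zero' (.of_forall fun _ => dist_nonneg) ?_ herr)
  filter_upwards [eventually_ge_atTop k,
    hθ0.abs.eventually_le_const (show |(0 : ℝ)| < 1 by simp)] with n hkn hn
  rw [dist_comm]
  refine (dist_triangle _ (Complex.exp (-(θ n * L n * Complex.I)) *
    ∫ N, Complex.exp (θ n * (misplacedFrom k n N : ℝ) * Complex.I) ∂(placementMeasure k n)) _).trans
    (add_le_add ?_ ?_)
  · rw [dist_eq_norm]
    exact norm_integral_exp_misplaced_sub_le k n (θ n) (L n)
  · rw [dist_eq_norm, ← mul_sub, norm_mul, integral_exp_misplacedFrom k n hkn]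
    have h1 : ‖Complex.exp (-(θ n * L n * Complex.I))‖ = 1 := by
      rw [← neg_mul, ← Complex.ofReal_mul, ← Complex.ofReal_neg, Complex.norm_exp_ofReal_mul_I]
    rw [h1, one_mul]
    refine (norm_prod_bernoulli_sub_exp_le _ (fun s _ => by positivity) (fun s hs => ?_) hn).trans
      (mul_le_mul_of_nonneg_right (hB n) (sq_nonneg _))
    rw [Finset.mem_Ioc] at hs
    exact div_le_one_of_le₀ (Nat.cast_le.2 hs.1.le) (Nat.cast_nonneg s)

theorem mainTheorem8 (k : ℕ) (hk : 1 ≤ k) :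
    Tendsto (fun n : ℕ => (∫ N, (misplaced n N : ℝ) ∂(placementMeasure k n)) / (k * Real.log n))
        atTop (𝓝 1) ∧
    Tendsto (fun n : ℕ => variance (fun N => (misplaced n N : ℝ)) (placementMeasure k n) /
        (k * Real.log n)) atTop (𝓝 1) ∧
    TendstoInDistribution
      (fun (n : ℕ) (N : Fin n → Fin n) =>
        ((misplaced n N : ℝ) - k * Real.log n) / Real.sqrt (k * Real.log n))
      atTop (id : ℝ → ℝ) (fun n => placementMeasure k n) (gaussianReal 0 1) := by
  refine ⟨tendsto_integral_misplaced hk, tendsto_variance_misplaced hk,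
    fun n => Measurable.of_discrete.aemeasurable, aemeasurable_id, ?_⟩
  refine ProbabilityMeasure.tendsto_iff_tendsto_charFun.2 fun t => ?_
  have hlim : charFun ((gaussianReal 0 1).map (id : ℝ → ℝ)) t =
      Complex.exp (-(t : ℂ) ^ 2 / 2) := by
    rw [Measure.map_id, charFun_gaussianReal]
    simp [neg_div]
  simp only [ProbabilityMeasure.coe_mk]
  rw [hlim]
  refine (tendsto_integral_exp_misplaced hk t).congr fun n => ?_
  rw [charFun_apply_real, integral_map Measurable.of_discrete.aemeasurable
    (by fun_prop)]
  refine integral_congr_ae (.of_forall fun N => ?_)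
  simp only []
  congr 1
  push_cast
  ring
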